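/- **Theorem 2.** Let $E$ and $Z$ be real reflexive Banach spaces with $E$ compactly embedded into $Z$ (so that $E$ is regarded as a linear subspace of $Z$, the inclusion being continuous and compact). Let $\Phi:E\to\mathbb R$ and $H:Z\to\mathbb R$ be convex and Fréchet differentiable, with derivatives $\varphi:E\to E^*$ and $h:Z\to Z^*$, and suppose that there are constants $\alpha>1$ and $\gamma>0$ with $$\gamma\|v\|^{\alpha}\le\langle\varphi(v),v\rangle\qquad\text{for all }v\in E.$$ Let $\rho>0$, let $B_\rho$ be the closed ball of radius $\rho$ centred at $0$ in $E$, and suppose that $x\mapsto\|h(x)\|_{Z^*}$ is bounded on $B_\rho$. For $\lambda>0$ put $J_\lambda(x)=\Phi(x)-\lambda H(x)$, $x\in E$; a critical point of $J_\lambda$ is a point $x\in E$ with $J_\lambda'(x)=0$. Then there is $\lambda^*>0$ such that the following holds for every $\lambda\in(0,\lambda^*]$. (i) $J_\lambda$ attains its infimum over $B_\rho$. Every $u\in B_\rho$ with $J_\lambda(u)=\inf_{B_\rho}J_\lambda$ (possibly on the boundary of the ball) is a critical point of $J_\lambda$, that is, $\varphi(u)=\lambda h(u)$ in $E^*$. If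 $J_\lambda(0)=0$ and $J_\lambda(v)<0$ for some $v\in B_\rho$, then $u\neq0$. (ii) Let $u\in B_\rho$ be such a minimizer, and assume in addition that (a) $J_\lambda$ satisfies the Palais–Smale condition: every sequence $(x_n)$ in $E$ with $(J_\lambda(x_n))$ bounded and $J_\lambda'(x_n)\to0$ in $E^*$ has a norm convergent subsequence; (b) $J_\lambda(u)<\inf\{J_\lambda(x):\|x\|=\rho_1\}$ for some $\rho_1>\|u\|$; (c) there is $w\in E$ with $\lim_{t\to\infty}J_\lambda(tw)=-\infty$. Then $J_\lambda$ has, besides $u$, another critical point $z$ with $z\neq0$ and $z\neq u$. -/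

import Mathlib

open Filter Topology

/-- A real normed space is reflexive if the canonical isometric inclusion into its topological
bidual is onto. -/
def IsReflexiveSpace (X : Type*) [NormedAddCommGroup X] [NormedSpace ℝ X] : Prop :=
  Function.Surjective (NormedSpace.inclusionInDoubleDual ℝ X)

/-- A compact embedding: an injective continuous linear map that is a compact operator. -/
structure IsCompactEmbedding {E Z : Type*} [NormedAddCommGroup E] [NormedSpace ℝ E]
    [NormedAddCommGroup Z] [NormedSpace ℝ Z] (ι : E →L[ℝ] Z) : Prop where
  injective : Function.Injective ι
  compact : IsCompactOperator ι

/-- The action functional `J = Φ - λ H` on `E`, where `E` is regarded as a subspace of `Z`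
through `ι`. -/
def actionFunctional {E Z : Type*} [NormedAddCommGroup E] [NormedSpace ℝ E]
    [NormedAddCommGroup Z] [NormedSpace ℝ Z] (ι : E →L[ℝ] Z) (Φ : E → ℝ) (H : Z → ℝ) (lam : ℝ) :
    E → ℝ :=
  fun x => Φ x - lam * H (ι x)

/-- `u` is a critical point of `J`: `J` is Fréchet differentiable at `u` with derivative `0`. -/
def IsCriticalPoint {E : Type*} [NormedAddCommGroup E] [NormedSpace ℝ E] (J : E → ℝ) (u : E) :
    Prop :=
  HasFDerivAt J (0 : StrongDual ℝ E) u

/-- The Palais–Smale condition for a differentiable functional: every sequence along which `J` is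
bounded and `J'` tends to `0` in the dual norm has a norm convergent subsequence. -/
def PalaisSmale {E : Type*} [NormedAddCommGroup E] [NormedSpace ℝ E] (J : E → ℝ) : Prop :=
  Differentiable ℝ J ∧
    ∀ x : ℕ → E, (∃ C : ℝ, ∀ n, |J (x n)| ≤ C) →
      Tendsto (fun n => fderiv ℝ J (x n)) atTop (𝓝 0) →
      ∃ (a : E) (σ : ℕ → ℕ), StrictMono σ ∧ Tendsto (x ∘ σ) atTop (𝓝 a)

/-! Convexity makes `Φ` grow by at least `δ = γ (ρ/2)^α` from the origin to the sphere of radius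
`ρ`, while `H ∘ ι` grows by at most `β ‖ι‖ ρ`. For small `lam` the first gain wins, so `J` on this
sphere is bounded below by a level above `J 0`.

The same smallness makes `J'` radially positive on the sphere. A minimizer over the ball therefore
has `J' = 0`. Minimizers exist because weak limits stay in the ball, `Φ` lies above its tangents and
`ι` turns weak limits into norm limits.

For the second critical point, this sphere separates `0` from a distant point `t • w` where `J` is
below `J u`. The mountain pass theorem, obtained from Ekeland's principle on the space of paths,
gives a critical value above `J 0 ≥ J u`, which excludes both `0` and `u`. -/

/-! ### Variational principle in complete metric spaces -/

/-- Ekeland's variational principle. -/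
theorem exists_ekeland_point {X : Type*} [MetricSpace X] [CompleteSpace X] {f : X → ℝ}
    (hf : LowerSemicontinuous f) (hbdd : BddBelow (Set.range f)) {ε : ℝ} (hε : 0 < ε) (x₀ : X) :
    ∃ x, f x + ε * dist x₀ x ≤ f x₀ ∧ ∀ y, f x ≤ f y + ε * dist x y := by
  let S : X → Set X := fun x => {y | f y + ε * dist x y ≤ f x}
  have hself (x : X) : x ∈ S x := by simp [S]
  have hSclosed (x : X) : IsClosed (S x) := by
    have hlsc : LowerSemicontinuous (fun y => f y + ε * dist x y) :=
      hf.add (Continuous.lowerSemicontinuous (by fun_prop))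
    exact lowerSemicontinuous_iff_isClosed_preimage.1 hlsc (f x)
  have hStrans {x y z : X} (hy : y ∈ S x) (hz : z ∈ S y) : z ∈ S x := by
    simp only [S, Set.mem_ofPred_eq] at *
    nlinarith [dist_triangle x y z]
  -- Near-minimizing over the nested sets `S x`, with error `2⁻ⁿ`, leaves no point of `S a` strictly
  -- below the limit `a`.
  have hstep (x : X) (n : ℕ) : ∃ y ∈ S x, ∀ z ∈ S x, f y ≤ f z + (1 / 2 : ℝ) ^ n := by
    have hne : (f '' S x).Nonempty := ⟨f x, x, hself x, rfl⟩
    have hb : BddBelow (f '' S x) := hbdd.mono (Set.image_subset_range _ _)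
    obtain ⟨_, ⟨y, hy, rfl⟩, hlt⟩ := exists_lt_of_csInf_lt hne
      (lt_add_of_pos_right (sInf (f '' S x)) (by positivity : (0 : ℝ) < (1 / 2 : ℝ) ^ n))
    refine ⟨y, hy, fun z hz => ?_⟩
    linarith [csInf_le hb (Set.mem_image_of_mem f hz)]
  choose next hnext_mem hnext_le using hstep
  let x : ℕ → X := fun n => Nat.rec x₀ (fun n y => next y n) n
  have hsucc (n : ℕ) : x (n + 1) ∈ S (x n) := hnext_mem _ _
  have hmem (n k : ℕ) : x (n + k) ∈ S (x n) := by
    induction k with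
    | zero => exact hself _
    | succ k ih => exact hStrans ih (hsucc _)
  have hanti : Antitone (f ∘ x) := antitone_nat_of_succ_le fun n => by
    have := hsucc n
    simp only [S, Set.mem_ofPred_eq] at this
    have h0 : 0 ≤ ε * dist (x n) (x (n + 1)) := by positivity
    simp only [Function.comp_apply]
    linarith
  have hlim := tendsto_atTop_ciInf hanti (hbdd.mono (Set.range_comp_subset_range x f))
  set L := ⨅ i, (f ∘ x) i
  have hLle (n : ℕ) : L ≤ f (x n) := ciInf_le (hbdd.mono (Set.range_comp_subset_range x f)) n
  have hcauchy : CauchySeq x := by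
    refine cauchySeq_of_le_tendsto_0' (fun n => (f (x n) - L) / ε) (fun n m hnm => ?_) ?_
    · obtain ⟨k, rfl⟩ := Nat.exists_eq_add_of_le hnm
      have := hmem n k
      simp only [S, Set.mem_ofPred_eq] at this
      rw [le_div_iff₀ hε]
      linarith [hLle (n + k)]
    · simpa using (hlim.sub_const L).div_const ε
  obtain ⟨a, ha⟩ := cauchySeq_tendsto_of_complete hcauchy
  have haS (n : ℕ) : a ∈ S (x n) := by
    refine (hSclosed (x n)).mem_of_tendsto ha ?_
    filter_upwards [eventually_ge_atTop n] with m hm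
    obtain ⟨k, rfl⟩ := Nat.exists_eq_add_of_le hm
    exact hmem n k
  refine ⟨a, haS 0, fun y => ?_⟩
  by_contra! hlt
  have hyS : y ∈ S a := hlt.le
  have hle (n : ℕ) : f a ≤ f y + (1 / 2 : ℝ) ^ n := by
    have h1 : f (x (n + 1)) ≤ f y + (1 / 2 : ℝ) ^ n := hnext_le _ _ _ (hStrans (haS n) hyS)
    have h2 := haS (n + 1)
    simp only [S, Set.mem_ofPred_eq] at h2
    have h0 : 0 ≤ ε * dist (x (n + 1)) a := by positivity
    linarith
  have hpow : Tendsto (fun n : ℕ => f y + (1 / 2 : ℝ) ^ n) atTop (𝓝 (f y + 0)) :=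
    (tendsto_pow_atTop_nhds_zero_of_lt_one (by norm_num) (by norm_num)).const_add _
  have := ge_of_tendsto' hpow hle
  have h0 : 0 ≤ ε * dist a y := by positivity
  linarith

/-! ### Differentiable convex functions -/

/-- The gradient inequality for a convex function. -/
theorem ConvexOn.hasFDerivAt_apply_sub_le {E : Type*} [NormedAddCommGroup E] [NormedSpace ℝ E]
    {f : E → ℝ} (hf : ConvexOn ℝ Set.univ f) {x : E} {f' : StrongDual ℝ E}
    (hx : HasFDerivAt f f' x) (y : E) : f' (y - x) ≤ f y - f x := by
  have hg : ConvexOn ℝ Set.univ (fun t : ℝ => f (AffineMap.lineMap x y t)) :=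
    hf.comp_affineMap (AffineMap.lineMap x y)
  have hd : HasDerivAt (fun t : ℝ => f (AffineMap.lineMap x y t)) (f' (y - x)) 0 := by
    have hx' : HasFDerivAt f f' (AffineMap.lineMap x y (0 : ℝ)) := by simpa using hx
    exact hx'.comp_hasDerivAt (0 : ℝ) AffineMap.hasDerivAt_lineMap
  have := hg.le_slope_of_hasDerivAt (Set.mem_univ 0) (Set.mem_univ 1) one_pos hd
  simpa [slope_def_field] using this

/-- The Fréchet derivative of an everywhere differentiable convex function is norm continuous. -/
theorem ConvexOn.continuous_of_hasFDerivAt {E : Type*} [NormedAddCommGroup E] [NormedSpace ℝ E]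
    {f : E → ℝ} {f' : E → StrongDual ℝ E} (hf : ConvexOn ℝ Set.univ f)
    (hd : ∀ x, HasFDerivAt f (f' x) x) : Continuous f' := by
  rw [continuous_iff_continuousAt]
  intro x
  rw [ContinuousAt, tendsto_iff_norm_sub_tendsto_zero, Metric.tendsto_nhds]
  intro ε hε
  have hε' : 0 < ε / 4 := by positivity
  have hlin := (hasFDerivAt_iff_isLittleO_nhds_zero.1 (hd x)).bound hε'
  obtain ⟨δ, hδ, hball⟩ := Metric.eventually_nhds_iff.1 hlin
  have hδ3 : 0 < δ / 3 := by positivity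
  filter_upwards [Metric.ball_mem_nhds x hδ3] with y hy
  rw [Metric.mem_ball, dist_eq_norm] at hy
  -- The gradient inequalities at `y` (towards `y + k`) and at `x` (towards `y`) add up to bound the
  -- left side by the Taylor remainder at `x` for the increment `y - x + k`, shorter than `δ`.
  have key (k : E) (hk : ‖k‖ = δ / 3) : (f' y - f' x) k ≤ ε / 4 * (2 * (δ / 3)) := by
    have hn : ‖y - x + k‖ ≤ 2 * (δ / 3) := by linarith [norm_add_le (y - x) k]
    have h1 := hball (y := y - x + k) (by rw [dist_zero_right]; linarith)
    have h2 := hf.hasFDerivAt_apply_sub_le (hd y) (y + k)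
    have h3 := hf.hasFDerivAt_apply_sub_le (hd x) y
    have h4 : x + (y - x + k) = y + k := by abel
    rw [h4, Real.norm_eq_abs, map_add] at h1
    have h5 := (abs_le.1 h1).2
    have h6 : ε / 4 * ‖y - x + k‖ ≤ ε / 4 * (2 * (δ / 3)) := by gcongr
    rw [add_sub_cancel_left] at h2
    rw [sub_apply]
    linarith
  have hle : ‖f' y - f' x‖ ≤ ε / 2 := by
    refine ContinuousLinearMap.opNorm_le_of_unit_norm (by positivity) fun z hz => ?_
    have hpos : ‖(δ / 3) • z‖ = δ / 3 := by
      rw [norm_smul, hz, mul_one, Real.norm_of_nonneg hδ3.le]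
    have h1 := key ((δ / 3) • z) hpos
    have h2 := key (-((δ / 3) • z)) (by rwa [norm_neg])
    rw [map_neg] at h2
    rw [map_smul, smul_eq_mul] at h1 h2
    rw [Real.norm_eq_abs, abs_le]
    constructor <;> nlinarith
  simp only [Real.dist_eq, sub_zero, abs_norm]
  linarith

/-! ### Weak limits and minimizers on balls -/

/-- Along an ultrafilter concentrated on a closed ball of a reflexive space, all functionals
converge to their values at a point of the ball. -/
theorem IsReflexiveSpace.exists_weak_limit {E : Type*} [NormedAddCommGroup E] [NormedSpace ℝ E]
    (hE : IsReflexiveSpace E) {r : ℝ} (hr : 0 ≤ r) (F : Ultrafilter E)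
    (hF : Metric.closedBall (0 : E) r ∈ F) :
    ∃ u ∈ Metric.closedBall (0 : E) r,
      ∀ f : StrongDual ℝ E, Tendsto (fun x => f x) F (𝓝 (f u)) := by
  have hlim (f : StrongDual ℝ E) :
      ∃ l ∈ Metric.closedBall (0 : ℝ) (‖f‖ * r), Tendsto (fun x => f x) F (𝓝 l) := by
    refine (isCompact_closedBall (0 : ℝ) (‖f‖ * r)).ultrafilter_le_nhds' (F.map fun x => f x) ?_
    refine Ultrafilter.mem_map.2 (Filter.mem_of_superset hF fun x hx => ?_)
    rw [mem_closedBall_zero_iff] at hx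
    rw [Set.mem_preimage, mem_closedBall_zero_iff]
    exact f.le_opNorm_of_le hx
  choose l hl_mem hl using hlim
  -- The limits form an element of the bidual of norm at most `r`, which reflexivity represents by a
  -- point.
  let lin : StrongDual ℝ E →ₗ[ℝ] ℝ :=
    { toFun := l
      map_add' := fun f g => tendsto_nhds_unique (hl (f + g)) ((hl f).add (hl g))
      map_smul' := fun c f => tendsto_nhds_unique (hl (c • f)) ((hl f).const_smul c) }
  let L : StrongDual ℝ (StrongDual ℝ E) := lin.mkContinuous r fun f => by
    have := hl_mem f
    rw [mem_closedBall_zero_iff] at this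
    rw [mul_comm]
    exact this
  obtain ⟨u, hu⟩ := hE L
  have hval (f : StrongDual ℝ E) : f u = l f := by
    rw [← NormedSpace.dual_def ℝ E u f, hu]
    rfl
  refine ⟨u, ?_, fun f => by rw [hval]; exact hl f⟩
  rw [mem_closedBall_zero_iff]
  refine NormedSpace.norm_le_dual_bound ℝ u hr fun f => ?_
  rw [hval, mul_comm]
  simpa using hl_mem f

/-- A compact operator maps weakly convergent bounded ultrafilters to norm convergent ones. -/
theorem IsCompactOperator.tendsto_of_weak_limit {E Z : Type*} [NormedAddCommGroup E]
    [NormedSpace ℝ E] [NormedAddCommGroup Z] [NormedSpace ℝ Z] {ι : E →L[ℝ] Z}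
    (hι : IsCompactOperator ι) {r : ℝ} {F : Ultrafilter E} (hF : Metric.closedBall (0 : E) r ∈ F)
    {u : E} (hu : ∀ f : StrongDual ℝ E, Tendsto (fun x => f x) F (𝓝 (f u))) :
    Tendsto ι F (𝓝 (ι u)) := by
  obtain ⟨K, hK, hsub⟩ := IsCompactOperator.image_closedBall_subset_compact
    (f := (ι : E →ₗ[ℝ] Z)) hι r
  obtain ⟨z, -, hz⟩ := hK.ultrafilter_le_nhds' (F.map ι)
    (Ultrafilter.mem_map.2 (Filter.mem_of_superset hF fun x hx => hsub (Set.mem_image_of_mem _ hx)))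
  have hz' : Tendsto ι F (𝓝 z) := hz
  have hzu : z = ι u := by
    refine (SeparatingDual.eq_iff_forall_dual_eq (R := ℝ)).2 fun g => ?_
    exact tendsto_nhds_unique ((g.continuous.tendsto z).comp hz') (hu (g.comp ι))
  rwa [← hzu]

/-- The action functional attains its minimum over every closed ball of a reflexive space. -/
theorem exists_isMinOn_actionFunctional {E Z : Type*} [NormedAddCommGroup E] [NormedSpace ℝ E]
    [NormedAddCommGroup Z] [NormedSpace ℝ Z] (hE : IsReflexiveSpace E) {ι : E →L[ℝ] Z}
    (hι : IsCompactOperator ι) {Φ : E → ℝ} {H : Z → ℝ} (hΦconv : ConvexOn ℝ Set.univ Φ)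
    (hΦ : Differentiable ℝ Φ) (hH : Continuous H) (lam : ℝ) {r : ℝ} (hr : 0 ≤ r) :
    ∃ u ∈ Metric.closedBall (0 : E) r,
      IsMinOn (actionFunctional ι Φ H lam) (Metric.closedBall (0 : E) r) u := by
  set J := actionFunctional ι Φ H lam with hJ
  set B := Metric.closedBall (0 : E) r
  have : Nonempty B := ⟨0, Metric.mem_closedBall_self hr⟩
  -- An ultrafilter finer than all sublevel sets plays the role of a minimizing sequence.
  let G : B → Filter E := fun y => 𝓟 {x ∈ B | J x ≤ J y}
  have hdir : Directed (· ≥ ·) G := by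
    intro y z
    rcases le_total (J y) (J z) with hyz | hyz
    · exact ⟨y, le_rfl, principal_mono.2 fun x hx => ⟨hx.1, hx.2.trans hyz⟩⟩
    · exact ⟨z, principal_mono.2 fun x hx => ⟨hx.1, hx.2.trans hyz⟩, le_rfl⟩
  have hne : NeBot (iInf G) := iInf_neBot_of_directed' hdir fun y =>
    principal_neBot_iff.2 ⟨y, y.2, le_rfl⟩
  let F : Ultrafilter E := Ultrafilter.of (iInf G)
  have hFG (y : B) : {x ∈ B | J x ≤ J y} ∈ F :=
    Ultrafilter.of_le (iInf G) (mem_iInf_of_mem y (mem_principal_self _))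
  have hFB : B ∈ F := Filter.mem_of_superset (hFG (Classical.arbitrary B)) fun x hx => hx.1
  obtain ⟨u, huB, hu⟩ := hE.exists_weak_limit hr F hFB
  refine ⟨u, huB, fun y hy => ?_⟩
  have hHlim : Tendsto (fun x => H (ι x)) F (𝓝 (H (ι u))) :=
    (hH.tendsto _).comp (hι.tendsto_of_weak_limit hFB hu)
  -- The tangent of `Φ` at `u` replaces weak lower semicontinuity: it is a minorant that converges.
  have hlow : Tendsto (fun x => Φ u + (fderiv ℝ Φ u x - fderiv ℝ Φ u u) - lam * H (ι x)) F
      (𝓝 (Φ u + (fderiv ℝ Φ u u - fderiv ℝ Φ u u) - lam * H (ι u))) :=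
    (((hu _).sub_const _).const_add _).sub (hHlim.const_mul _)
  rw [sub_self, add_zero] at hlow
  refine le_of_tendsto hlow ?_
  filter_upwards [hFG ⟨y, hy⟩] with x hx
  have h1 := hΦconv.hasFDerivAt_apply_sub_le (hΦ u).hasFDerivAt x
  rw [map_sub] at h1
  have h2 : Φ x - lam * H (ι x) ≤ J y := hx.2
  linarith

/-! ### Mountain pass theorem -/

open unitInterval in
/-- If a path minimizes the maximum of `J` up to a penalty `ε ‖v‖` among its perturbations `v` with
fixed endpoints, then the derivative of `J` is of norm at most `ε` at a maximum point of the path. -/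
theorem exists_norm_fderiv_le_of_path {E : Type*} [NormedAddCommGroup E] [NormedSpace ℝ E]
    {J : E → ℝ} (hJ : Differentiable ℝ J) (hJ' : Continuous (fderiv ℝ J)) (g : C(I, E)) {ε : ℝ}
    (hε : 0 < ε) (hends : ∃ t, J (g 0) < J (g t) ∧ J (g 1) < J (g t))
    (hmin : ∀ v : C(I, E), v 0 = 0 → v 1 = 0 →
      ∃ t, ∀ s, J (g s) ≤ J (g t + v t) + ε * ‖v‖) :
    ∃ t, (∀ s, J (g s) ≤ J (g t)) ∧ ‖fderiv ℝ J (g t)‖ ≤ ε := by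
  by_contra! hcon
  have hJc : Continuous J := hJ.continuous
  let M : Set I := {t | ∀ s, J (g s) ≤ J (g t)}
  have hMclosed : IsClosed M := by
    simp only [M, Set.ofPred_forall]
    exact isClosed_iInter fun s => isClosed_le continuous_const (by fun_prop)
  obtain ⟨t₁, ht0, ht1⟩ := hends
  -- Admissible descent directions: steep on `M`, zero at the endpoints. These conditions are convex
  -- and locally solvable by constants, since the endpoints are not in `M`, so a continuous
  -- selection exists.
  let T : I → Set E := fun t =>
    {v | ‖v‖ ≤ 1 ∧ (t ∈ M → fderiv ℝ J (g t) v < -ε) ∧ (t = 0 ∨ t = 1 → v = 0)}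
  have hTconv (t : I) : Convex ℝ (T t) := by
    have h1 : Convex ℝ {v : E | ‖v‖ ≤ 1} := by
      simpa [Metric.closedBall, dist_zero_right] using convex_closedBall (0 : E) 1
    have h2 : Convex ℝ {v : E | t ∈ M → fderiv ℝ J (g t) v < -ε} := by
      by_cases ht : t ∈ M
      · simpa [ht] using convex_halfSpace_lt (fderiv ℝ J (g t)).toLinearMap.isLinear (-ε)
      · simpa [ht] using convex_univ
    have h3 : Convex ℝ {v : E | t = 0 ∨ t = 1 → v = 0} := by
      by_cases ht : t = 0 ∨ t = 1
      · simp [ht]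
      · simpa [ht] using convex_univ
    exact h1.inter (h2.inter h3)
  have hTloc (t : I) : ∃ c : E, ∀ᶠ s in 𝓝 t, c ∈ T s := by
    by_cases ht : t ∈ M
    · obtain ⟨x, hx1, hx⟩ := (fderiv ℝ J (g t)).exists_lt_apply_of_lt_opNorm (hcon t ht)
      obtain ⟨c, hc1, hc⟩ : ∃ c : E, ‖c‖ ≤ 1 ∧ fderiv ℝ J (g t) c < -ε := by
        rw [Real.norm_eq_abs] at hx
        rcases lt_abs.1 hx with h | h
        · exact ⟨-x, by rw [norm_neg]; exact hx1.le, by rw [map_neg]; linarith⟩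
        · exact ⟨x, hx1.le, by linarith⟩
      refine ⟨c, ?_⟩
      have hopen : IsOpen {s : I | fderiv ℝ J (g s) c < -ε} :=
        isOpen_lt (by fun_prop) continuous_const
      have h0 : t ≠ 0 := by rintro rfl; exact absurd (ht t₁) (not_le.2 ht0)
      have h1 : t ≠ 1 := by rintro rfl; exact absurd (ht t₁) (not_le.2 ht1)
      filter_upwards [hopen.mem_nhds hc, isOpen_ne.mem_nhds h0, isOpen_ne.mem_nhds h1]
        with s hs hs0 hs1
      exact ⟨hc1, fun _ => hs, fun h => (h.elim hs0 hs1).elim⟩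
    · refine ⟨0, ?_⟩
      filter_upwards [hMclosed.isOpen_compl.mem_nhds ht] with s hs
      exact ⟨by simp, fun h => (hs h).elim, fun _ => rfl⟩
  obtain ⟨v, hv⟩ := exists_continuous_forall_mem_convex_of_local_const hTconv hTloc
  have hvnorm : ‖v‖ ≤ 1 := (ContinuousMap.norm_le _ zero_le_one).2 fun t => (hv t).1
  let r : ℕ → ℝ := fun n => 1 / ((n : ℝ) + 1)
  have hr (n : ℕ) : 0 < r n := Nat.one_div_pos_of_nat
  have hrlim : Tendsto r atTop (𝓝 0) := tendsto_one_div_add_atTop_nhds_zero_nat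
  -- Moving the path by `r n • v` lowers its maximum by at most `ε * r n`. The mean value theorem
  -- then gives a slope of at least `-ε` near a maximum of the moved path; in the limit this
  -- contradicts the choice of `v` on `M`.
  have hstep (n : ℕ) : ∃ t : I, ∃ z : E, (∀ s, J (g s) ≤ J (g t + r n • v t) + ε * r n) ∧
      ‖z - g t‖ ≤ r n ∧ -ε ≤ fderiv ℝ J z (v t) := by
    obtain ⟨t, ht⟩ := hmin (r n • v) (by simp [(hv 0).2.2 (Or.inl rfl)])
      (by simp [(hv 1).2.2 (Or.inr rfl)])
    have hnorm : ‖r n • v‖ ≤ r n := by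
      rw [norm_smul, Real.norm_of_nonneg (hr n).le]
      exact mul_le_of_le_one_right (hr n).le hvnorm
    have ht' (s : I) : J (g s) ≤ J (g t + r n • v t) + ε * r n :=
      (ht s).trans (by simp only [ContinuousMap.smul_apply]; gcongr)
    obtain ⟨z, hz, hzeq⟩ := domain_mvt (f := J) (s := Set.univ) (x := g t) (y := g t + r n • v t)
      (fun x _ => (hJ x).hasFDerivAt.hasFDerivWithinAt) convex_univ (Set.mem_univ _)
      (Set.mem_univ _)
    refine ⟨t, z, ht', ?_, ?_⟩
    · have h1 := norm_sub_le_of_mem_segment hz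
      rw [add_sub_cancel_left, norm_smul, Real.norm_of_nonneg (hr n).le] at h1
      exact h1.trans (mul_le_of_le_one_right (hr n).le (hv t).1)
    · rw [add_sub_cancel_left, map_smul, smul_eq_mul] at hzeq
      have h1 := ht' t
      have h2 : 0 ≤ r n * (fderiv ℝ J z (v t) + ε) := by linarith
      linarith [nonneg_of_mul_nonneg_right h2 (hr n)]
  choose t z hmax hz hder using hstep
  obtain ⟨a, k, hk, hta⟩ := CompactSpace.tendsto_subseq t
  have hrk : Tendsto (fun n => r (k n)) atTop (𝓝 0) := hrlim.comp hk.tendsto_atTop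
  have hga : Tendsto (fun n => g (t (k n))) atTop (𝓝 (g a)) := (g.continuous.tendsto a).comp hta
  have hva : Tendsto (fun n => v (t (k n))) atTop (𝓝 (v a)) := (v.continuous.tendsto a).comp hta
  have hza : Tendsto (fun n => z (k n)) atTop (𝓝 (g a)) := by
    have h0 : Tendsto (fun n => z (k n) - g (t (k n))) atTop (𝓝 0) :=
      squeeze_zero_norm (fun n => hz (k n)) hrk
    simpa using h0.add hga
  have haM : a ∈ M := by
    intro s
    have hlim : Tendsto (fun n => J (g (t (k n)) + r (k n) • v (t (k n))) + ε * r (k n)) atTop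
        (𝓝 (J (g a + (0 : ℝ) • v a) + ε * 0)) :=
      ((hJc.tendsto _).comp (hga.add (hrk.smul hva))).add (hrk.const_mul ε)
    rw [zero_smul, add_zero, mul_zero, add_zero] at hlim
    exact ge_of_tendsto' hlim fun n => hmax (k n) s
  have hderlim : Tendsto (fun n => fderiv ℝ J (z (k n)) (v (t (k n)))) atTop
      (𝓝 (fderiv ℝ J (g a) (v a))) :=
    (isBoundedBilinearMap_apply.continuous.tendsto (fderiv ℝ J (g a), v a)).comp
      (((hJ'.tendsto _).comp hza).prodMk_nhds hva)
  exact absurd ((hv a).2.1 haM) (not_lt.2 (ge_of_tendsto' hderlim fun n => hder (k n)))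

open unitInterval in
/-- The mountain pass theorem of Ambrosetti and Rabinowitz. -/
theorem PalaisSmale.exists_isCriticalPoint_of_mountainPass {E : Type*} [NormedAddCommGroup E]
    [NormedSpace ℝ E] [CompleteSpace E] {J : E → ℝ} (hPS : PalaisSmale J)
    (hJ' : Continuous (fderiv ℝ J)) {a b : E} {m : ℝ} (ha : J a < m) (hb : J b < m)
    (hpass : ∀ g : C(I, E), g 0 = a → g 1 = b → ∃ t, m ≤ J (g t)) :
    ∃ z, IsCriticalPoint J z ∧ m ≤ J z := by
  have hJ := hPS.1
  have hJc : Continuous J := hJ.continuous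
  let X := {g : C(I, E) // g 0 = a ∧ g 1 = b}
  have hXclosed : IsClosed {g : C(I, E) | g 0 = a ∧ g 1 = b} :=
    (isClosed_eq (by fun_prop) continuous_const).inter (isClosed_eq (by fun_prop) continuous_const)
  have : CompleteSpace X := hXclosed.completeSpace_coe
  let g₀ : X := ⟨⟨fun t => AffineMap.lineMap a b (t : ℝ), by fun_prop⟩, by simp, by simp⟩
  let Ψ : X → ℝ := fun g => ⨆ t, J (g.1 t)
  have hcont (g : X) : Continuous fun t => J (g.1 t) := hJc.comp g.1.continuous
  have hbdd (g : X) : BddAbove (Set.range fun t => J (g.1 t)) :=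
    (isCompact_range (hcont g)).bddAbove
  have hleΨ (g : X) (t : I) : J (g.1 t) ≤ Ψ g := le_ciSup (hbdd g) t
  have hattain (g : X) : ∃ t, J (g.1 t) = Ψ g := by
    obtain ⟨t, -, ht⟩ := isCompact_univ.exists_isMaxOn (Set.univ_nonempty (α := I))
      (hcont g).continuousOn
    exact ⟨t, le_antisymm (hleΨ g t) (ciSup_le fun s => ht (Set.mem_univ s))⟩
  have hmΨ (g : X) : m ≤ Ψ g := by
    obtain ⟨t, ht⟩ := hpass g.1 g.2.1 g.2.2
    exact ht.trans (hleΨ g t)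
  have hbelow : BddBelow (Set.range Ψ) := ⟨m, by rintro _ ⟨g, rfl⟩; exact hmΨ g⟩
  have hlsc : LowerSemicontinuous Ψ := lowerSemicontinuous_ciSup hbdd fun t =>
    Continuous.lowerSemicontinuous
      (hJc.comp ((continuous_eval_const t).comp continuous_subtype_val))
  have hstep (n : ℕ) : ∃ x : E, m ≤ J x ∧ J x ≤ Ψ g₀ ∧ ‖fderiv ℝ J x‖ ≤ 1 / ((n : ℝ) + 1) := by
    have hε : (0 : ℝ) < 1 / ((n : ℝ) + 1) := Nat.one_div_pos_of_nat
    -- Starting always from the same `g₀` keeps the values of `J` bounded, as Palais–Smale requires.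
    obtain ⟨g, hg0, hg⟩ := exists_ekeland_point hlsc hbelow hε g₀
    obtain ⟨t, ht, hder⟩ := exists_norm_fderiv_le_of_path hJ hJ' g.1 hε (by
      obtain ⟨t, ht⟩ := hattain g
      refine ⟨t, ?_, ?_⟩
      · rw [g.2.1, ht]; exact ha.trans_le (hmΨ g)
      · rw [g.2.2, ht]; exact hb.trans_le (hmΨ g)) (fun v hv0 hv1 => by
      let g' : X := ⟨g.1 + v, by simp [hv0, g.2.1], by simp [hv1, g.2.2]⟩
      obtain ⟨t, ht⟩ := hattain g'
      refine ⟨t, fun s => (hleΨ g s).trans ((hg g').trans_eq ?_)⟩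
      rw [← ht, Subtype.dist_eq, dist_eq_norm]
      simp [g'])
    obtain ⟨t', ht'⟩ := hattain g
    have hΨ : J (g.1 t) = Ψ g := le_antisymm (hleΨ g t) (ht' ▸ ht t')
    refine ⟨g.1 t, hΨ ▸ hmΨ g, ?_, hder⟩
    have h0 : 0 ≤ 1 / ((n : ℝ) + 1) * dist g₀ g := by positivity
    rw [hΨ]
    linarith
  choose x hmx hxΨ hx using hstep
  have hder : Tendsto (fun n => fderiv ℝ J (x n)) atTop (𝓝 0) :=
    squeeze_zero_norm hx tendsto_one_div_add_atTop_nhds_zero_nat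
  obtain ⟨z, k, hk, hz⟩ := hPS.2 x ⟨max |m| |Ψ g₀|, fun n => abs_le_max_abs_abs (hmx n) (hxΨ n)⟩
    hder
  have hzero : fderiv ℝ J z = 0 :=
    tendsto_nhds_unique ((hJ'.tendsto z).comp hz) (hder.comp hk.tendsto_atTop)
  refine ⟨z, ?_, ge_of_tendsto' ((hJc.tendsto z).comp hz) fun n => hmx (k n)⟩
  rw [IsCriticalPoint, ← hzero]
  exact (hJ z).hasFDerivAt

/-! ### First-order conditions at the origin and on balls -/

/-- A continuous operator `φ : E → E*` with `0 ≤ ⟨φ(v), v⟩` for all `v` vanishes at the origin. -/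
theorem eq_zero_of_apply_self_nonneg {E : Type*} [NormedAddCommGroup E] [NormedSpace ℝ E]
    {φ : E → StrongDual ℝ E} (hc : Continuous φ) (hφ : ∀ v, 0 ≤ φ v v) : φ 0 = 0 := by
  have hnonneg (v : E) : 0 ≤ φ 0 v := by
    -- For `t > 0`, the sign of `φ (t • v) v` is that of `φ (t • v) (t • v)`.
    have hlim : Tendsto (fun t : ℝ => φ (t • v) v) (𝓝[>] 0) (𝓝 (φ ((0 : ℝ) • v) v)) :=
      (Continuous.tendsto (by fun_prop : Continuous fun t : ℝ => φ (t • v) v) 0).mono_left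
        nhdsWithin_le_nhds
    rw [zero_smul] at hlim
    refine ge_of_tendsto hlim ?_
    filter_upwards [self_mem_nhdsWithin] with t ht
    have h := hφ (t • v)
    rw [map_smul, smul_eq_mul] at h
    exact nonneg_of_mul_nonneg_right h ht
  ext v
  have h := hnonneg (-v)
  rw [map_neg] at h
  exact le_antisymm (by simpa using h) (hnonneg v)

/-- A differentiable function on a closed ball about the origin whose derivative is radially
positive on the bounding sphere has only interior minimizers, and these are zeros of the
derivative. -/
theorem IsMinOn.hasFDerivAt_eq_zero_of_closedBall {E : Type*} [NormedAddCommGroup E]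
    [NormedSpace ℝ E] {J : E → ℝ} {J' : StrongDual ℝ E} {r : ℝ} {u : E}
    (hu : u ∈ Metric.closedBall (0 : E) r) (hmin : IsMinOn J (Metric.closedBall (0 : E) r) u)
    (hJ : HasFDerivAt J J' u) (hpos : ‖u‖ = r → 0 < J' u) : J' = 0 := by
  rw [mem_closedBall_zero_iff] at hu
  rcases hu.lt_or_eq with hlt | heq
  · refine IsLocalMin.hasFDerivAt_eq_zero (hmin.isLocalMin ?_) hJ
    exact mem_of_superset (Metric.isOpen_ball.mem_nhds (mem_ball_zero_iff.2 hlt))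
      Metric.ball_subset_closedBall
  -- From the boundary one may still move towards the centre, so minimality forces `J' (-u) ≥ 0`.
  · have hseg : segment ℝ u 0 ⊆ Metric.closedBall (0 : E) r :=
      (convex_closedBall 0 r).segment_subset (mem_closedBall_zero_iff.2 hu)
        (Metric.mem_closedBall_self ((norm_nonneg u).trans hu))
    have h := hmin.localize.hasFDerivWithinAt_nonneg hJ.hasFDerivWithinAt
      (sub_mem_posTangentConeAt_of_segment_subset hseg)
    rw [zero_sub, map_neg] at h
    linarith [hpos heq]

/-! ### The two critical points -/

theorem theorem2 {E Z : Type*}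
    [NormedAddCommGroup E] [NormedSpace ℝ E] [CompleteSpace E]
    [NormedAddCommGroup Z] [NormedSpace ℝ Z] [CompleteSpace Z]
    -- `E` and `Z` are reflexive and `E` is compactly embedded into `Z`
    (hE : IsReflexiveSpace E) (hZ : IsReflexiveSpace Z)
    (ι : E →L[ℝ] Z) (hι : IsCompactEmbedding ι)
    -- `Φ` and `H` are convex with Fréchet derivatives `φ` and `h`
    (Φ : E → ℝ) (H : Z → ℝ) (φ : E → StrongDual ℝ E) (h : Z → StrongDual ℝ Z)
    (hΦconv : ConvexOn ℝ Set.univ Φ) (hHconv : ConvexOn ℝ Set.univ H)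
    (hφ : ∀ x, HasFDerivAt Φ (φ x) x) (hh : ∀ z, HasFDerivAt H (h z) z)
    -- growth of `φ`
    (α γ : ℝ) (hα : 1 < α) (hγ : 0 < γ) (hgrowth : ∀ v : E, γ * ‖v‖ ^ α ≤ φ v v)
    -- `‖h‖` is bounded on the ball
    (ρ : ℝ) (hρ : 0 < ρ)
    (hbdd : ∃ β : ℝ, ∀ x ∈ Metric.closedBall (0 : E) ρ, ‖h (ι x)‖ ≤ β) :
    ∃ lamStar : ℝ, 0 < lamStar ∧ ∀ lam ∈ Set.Ioc 0 lamStar,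
      -- `J` has a minimizer over the closed ball
      (∃ u ∈ Metric.closedBall (0 : E) ρ,
        IsMinOn (actionFunctional ι Φ H lam) (Metric.closedBall (0 : E) ρ) u) ∧
      ∀ u ∈ Metric.closedBall (0 : E) ρ,
        IsMinOn (actionFunctional ι Φ H lam) (Metric.closedBall (0 : E) ρ) u →
        -- every such minimizer is a critical point and solves the Euler–Lagrange equation
        IsCriticalPoint (actionFunctional ι Φ H lam) u ∧
        φ u = lam • (h (ι u)).comp ι ∧
        -- nontriviality
        ((∃ v ∈ Metric.closedBall (0 : E) ρ, actionFunctional ι Φ H lam v < 0) →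
          actionFunctional ι Φ H lam 0 = 0 → u ≠ 0) ∧
        -- the second critical point
        (PalaisSmale (actionFunctional ι Φ H lam) →
          (∃ ρ₁ : ℝ, ‖u‖ < ρ₁ ∧ (actionFunctional ι Φ H lam u : EReal) <
            ⨅ x ∈ Metric.sphere (0 : E) ρ₁, (actionFunctional ι Φ H lam x : EReal)) →
          (∃ w : E, Tendsto (fun t : ℝ => actionFunctional ι Φ H lam (t • w)) atTop atBot) →
          ∃ z : E, IsCriticalPoint (actionFunctional ι Φ H lam) z ∧ z ≠ 0 ∧ z ≠ u) := by
  obtain ⟨β, hβ⟩ := hbdd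
  have hφc : Continuous φ := hΦconv.continuous_of_hasFDerivAt hφ
  have hhc : Continuous h := hHconv.continuous_of_hasFDerivAt hh
  have hφ0 : φ 0 = 0 := eq_zero_of_apply_self_nonneg hφc fun v =>
    (by positivity : 0 ≤ γ * ‖v‖ ^ α).trans (hgrowth v)
  have hβ0 : 0 ≤ β := (norm_nonneg _).trans (hβ 0 (Metric.mem_closedBall_self hρ.le))
  have hhle {x : E} (hx : ‖x‖ = ρ) : h (ι x) (ι x) ≤ β * ‖ι‖ * ρ := by
    have h1 := hβ x (mem_closedBall_zero_iff.2 hx.le)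
    calc h (ι x) (ι x) ≤ ‖h (ι x) (ι x)‖ := Real.le_norm_self _
      _ ≤ ‖h (ι x)‖ * ‖ι x‖ := (h (ι x)).le_opNorm _
      _ ≤ β * (‖ι‖ * ρ) := by gcongr; exact hx ▸ ι.le_opNorm x
      _ = β * ‖ι‖ * ρ := by ring
  -- The gradient inequality at the midpoint `y = x / 2` gives `Φ x - Φ y ≥ φ y y ≥ δ`, and `φ 0 =
  -- 0` gives `Φ y ≥ Φ 0`. As `δ ≤ γ * ρ ^ α`, the same constant serves for radial positivity.
  set δ := γ * (ρ / 2) ^ α with hδdef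
  have hδ : 0 < δ := by positivity
  have hδle : δ ≤ γ * ρ ^ α := by
    rw [hδdef]
    gcongr
    linarith
  have hΦδ {x : E} (hx : ‖x‖ = ρ) : Φ 0 + δ ≤ Φ x := by
    let y : E := (1 / 2 : ℝ) • x
    have hy : ‖y‖ = ρ / 2 := by
      rw [norm_smul, hx, Real.norm_of_nonneg (by norm_num)]
      ring
    have h1 := hΦconv.hasFDerivAt_apply_sub_le (hφ y) x
    have h2 := hΦconv.hasFDerivAt_apply_sub_le (hφ 0) y
    have h3 := hgrowth y
    have h4 : x - y = y := by simp only [y]; module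
    rw [h4] at h1
    rw [hφ0, zero_apply] at h2
    rw [hy] at h3
    linarith
  have hHx {x : E} (hx : ‖x‖ = ρ) : H (ι x) ≤ H (ι 0) + β * ‖ι‖ * ρ := by
    have h1 := hHconv.hasFDerivAt_apply_sub_le (hh (ι x)) (ι 0)
    rw [map_zero, zero_sub, map_neg] at h1
    rw [map_zero]
    linarith [hhle hx]
  have hden : 0 < (β * ‖ι‖ + 1) * ρ := by positivity
  -- The `+ 1` keeps the denominator positive and makes `hgap` strict even at `lam = lamStar`.
  refine ⟨δ / ((β * ‖ι‖ + 1) * ρ), by positivity, fun lam hlam => ?_⟩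
  have hlam0 : 0 < lam := hlam.1
  have hgap : lam * (β * ‖ι‖ * ρ) < δ := by
    have h1 := (le_div_iff₀ hden).1 hlam.2
    nlinarith [mul_pos hlam0 hρ]
  set J := actionFunctional ι Φ H lam with hJdef
  have hJd (x : E) : HasFDerivAt J (φ x - lam • (h (ι x)).comp ι) x :=
    (hφ x).sub (((hh (ι x)).comp x ι.hasFDerivAt).const_mul lam)
  have hJ' : Continuous (fderiv ℝ J) := by
    have heq : fderiv ℝ J = fun x => φ x - lam • (h (ι x)).comp ι :=
      funext fun x => (hJd x).fderiv
    rw [heq]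
    fun_prop
  have hΦd : Differentiable ℝ Φ := fun x => (hφ x).differentiableAt
  have hHc : Continuous H := continuous_iff_continuousAt.2 fun z => (hh z).continuousAt
  refine ⟨exists_isMinOn_actionFunctional hE hι.compact hΦconv hΦd hHc lam hρ.le,
    fun u hu hmin => ?_⟩
  have hzero : φ u - lam • (h (ι u)).comp ι = 0 := by
    refine hmin.hasFDerivAt_eq_zero_of_closedBall hu (hJd u) fun hnorm => ?_
    have h1 := hgrowth u
    rw [hnorm] at h1
    have h2 : lam * h (ι u) (ι u) ≤ lam * (β * ‖ι‖ * ρ) := by gcongr; exact hhle hnorm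
    simp only [sub_apply, smul_apply, ContinuousLinearMap.comp_apply, smul_eq_mul]
    linarith
  have hJu0 : J u ≤ J 0 := hmin (Metric.mem_closedBall_self hρ.le)
  refine ⟨(hzero ▸ hJd u : HasFDerivAt J 0 u), sub_eq_zero.1 hzero, ?_, ?_⟩
  · rintro ⟨v, hv, hneg⟩ hJ0 rfl
    have : J 0 ≤ J v := hmin hv
    linarith
  · rintro hPS - ⟨w, hw⟩
    obtain ⟨t, ht⟩ := (hw.eventually (eventually_lt_atBot (J u))).exists
    -- A value below the minimum over the ball can only occur outside it.
    have hfar : ρ < ‖t • w‖ := by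
      by_contra! hle
      exact absurd (hmin (mem_closedBall_zero_iff.2 hle)) (not_le.2 ht)
    have hsphere {x : E} (hx : ‖x‖ = ρ) : J 0 + (δ - lam * (β * ‖ι‖ * ρ)) ≤ J x := by
      have h1 : lam * H (ι x) ≤ lam * (H (ι 0) + β * ‖ι‖ * ρ) := by gcongr; exact hHx hx
      have h2 := hΦδ hx
      simp only [hJdef, actionFunctional]
      linarith
    -- Every path from `0` to `t • w` crosses the sphere of radius `ρ`, where `J` is at least a
    -- level strictly above `J 0`.
    obtain ⟨z, hz, hJz⟩ := hPS.exists_isCriticalPoint_of_mountainPass hJ'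
      (a := 0) (b := t • w) (m := J 0 + (δ - lam * (β * ‖ι‖ * ρ))) (by linarith) (by linarith)
      fun g hg0 hg1 => by
        obtain ⟨s, hs⟩ := mem_range_of_exists_le_of_exists_ge (c := ρ)
          (show Continuous fun s => ‖g s‖ by fun_prop) ⟨0, by simp [hg0, hρ.le]⟩
          ⟨1, by rw [hg1]; exact hfar.le⟩
        exact ⟨s, hsphere hs⟩
    refine ⟨z, hz, ?_, ?_⟩
    · rintro rfl
      linarith
    · rintro rfl
      linarith
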